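/- Let $X$ be a (connected) Riemann surface and let $\mathcal V$ be a projectively flat holomorphic vector bundle of rank $n$ on $X$: $\mathcal V$ is given with holomorphic trivializations over an open cover $\{U_i\}$ of $X$ whose transition functions are $\lambda_{ij}T_{ij}$ with $\lambda_{ij}\colon U_i\cap U_j\to\mathbb C^\times$ holomorphic and $T_{ij}\in GL_n(\mathbb C)$ constant. A local holomorphic trivialization $e$ of $\mathcal V$ is called projectively flat if its transition functions to all the given ones are of the same form (nowhere vanishing holomorphic function times constant matrix). In a holomorphic coordinate $z$ on $X$ and a projectively flat trivialization, a meromorphic section $A$ of $\mathcal V$ is a row vector $(a_1,\dots,a_n)$ of meromorphic functions; its Wronskian matrix $W(A)$ has rows $A,A',\dots,A^{(n-1)}$ (derivatives with respect to $z$). A meromorphic section $B$ is called generic if $\det W(B)\not\equiv 0$ in some coordinate chart and projectively flat trivialization. Matrices and endomorphisms act on row vectors from the right, and products are taken accordingly. Meromorphic functions and sections are identified when they agree off a closed discrete set. Let $A,B$ be meromorphic sections of $\mathcal V$ with $B$ generic. Then the local endomorphisms given by the matrices $W(B)^{-1}W(A)$ do not depend on the choice of the local chart of $X$ and of the projectively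 flat trivialization of $\mathcal V$: they agree on overlaps and glue to a global meromorphic section $\frac AB$ of $\mathrm{End}(\mathcal V)$, which is given by $W(B)^{-1}W(A)$ in every local chart and projectively flat trivialization. Furthermore, for any three generic meromorphic sections $A,B,C$ of $\mathcal V$, $$\frac AB\cdot\frac CA\cdot\frac BC=1,$$ and for any meromorphic sections $A,B$ with $B$ generic and any meromorphic function $f$ on $X$ that is not identically zero, $fA$ and $fB$ are meromorphic sections, $fB$ is generic, and $$\frac{fA}{fB}=\frac AB.$$ -/

import Mathlib

open Bundle Filter Topology Manifold
open scoped ContDiff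

noncomputable section

/-- A (set-theoretic, junk-valued at poles) complex function `f` on a Riemann surface is
meromorphic if it is meromorphic in a holomorphic coordinate around every point. As usual, two
meromorphic functions are identified if they agree off a closed discrete set. -/
def IsMeromorphicFunction {X : Type*} [TopologicalSpace X] [ChartedSpace ℂ X] (f : X → ℂ) : Prop :=
  ∀ x : X, MeromorphicAt (fun z : ℂ => f ((chartAt ℂ x).symm z)) (chartAt ℂ x x)

/-- A meromorphic section of a holomorphic vector bundle `E` with model fibre `F` over a Riemann
surface: around every point its coordinate vector in a holomorphic frame, written in a holomorphic
coordinate of the surface, is meromorphic. Values at poles are arbitrary; two meromorphic sections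
are identified if they agree off a closed discrete set. -/
def IsMeromorphicSection {X : Type*} [TopologicalSpace X] [ChartedSpace ℂ X]
    (F : Type*) [NormedAddCommGroup F] [NormedSpace ℂ F]
    (E : X → Type*) [TopologicalSpace (TotalSpace F E)] [∀ x, TopologicalSpace (E x)]
    [FiberBundle F E] (A : ∀ x, E x) : Prop :=
  ∀ x : X, MeromorphicAt
    (fun z : ℂ => (trivializationAt F E x
      ⟨(chartAt ℂ x).symm z, A ((chartAt ℂ x).symm z)⟩).2) (chartAt ℂ x x)

/-- The Wronskian matrix of `a = (a₁, …, aₙ)`: its rows are `a, a', …, a⁽ⁿ⁻¹⁾`. -/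
def wronskianMatrix {n : ℕ} (a : ℂ → Fin n → ℂ) (z : ℂ) : Matrix (Fin n) (Fin n) ℂ :=
  Matrix.of fun i j => iteratedDeriv (i : ℕ) (fun w => a w j) z

section Bundles

variable {X : Type*} [TopologicalSpace X] [ChartedSpace ℂ X]
  (n : ℕ) (V : X → Type*) [TopologicalSpace (TotalSpace (Fin n → ℂ) V)]
  [∀ x, TopologicalSpace (V x)] [∀ x, AddCommGroup (V x)] [∀ x, Module ℂ (V x)]
  [FiberBundle (Fin n → ℂ) V]

/-- A holomorphic local trivialization (local holomorphic frame) of the vector bundle `V` of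
rank `n`. It need not belong to the atlas of trivializations that `V` comes with. -/
structure HolomorphicTrivialization where
  /-- the underlying topological trivialization -/
  triv : Trivialization (Fin n → ℂ) (π (Fin n → ℂ) V)
  isLinear : triv.IsLinear ℂ
  holomorphic : ContMDiffOn (𝓘(ℂ).prod 𝓘(ℂ, Fin n → ℂ)) (𝓘(ℂ).prod 𝓘(ℂ, Fin n → ℂ)) ω
    triv triv.source
  holomorphic_symm : ContMDiffOn (𝓘(ℂ).prod 𝓘(ℂ, Fin n → ℂ)) (𝓘(ℂ).prod 𝓘(ℂ, Fin n → ℂ)) ω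
    triv.toOpenPartialHomeomorph.symm triv.target

attribute [instance] HolomorphicTrivialization.isLinear

variable {n V}

/-- The transition between two trivializations is projectively flat: on the overlap it is
`l • T` with `T ∈ GLₙ(ℂ)` constant and `l` a nowhere vanishing holomorphic function. Coordinate
vectors are row vectors, on which matrices act from the right. -/
def ProjFlatTransition (e e' : HolomorphicTrivialization n V) : Prop :=
  ∃ (T : GL (Fin n) ℂ) (l : X → ℂ),
    ContMDiffOn 𝓘(ℂ) 𝓘(ℂ) ω l (e.triv.baseSet ∩ e'.triv.baseSet) ∧
    ∀ x ∈ e.triv.baseSet ∩ e'.triv.baseSet, l x ≠ 0 ∧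
      ∀ v : V x, (e'.triv ⟨x, v⟩).2 = l x • Matrix.vecMul (e.triv ⟨x, v⟩).2 (T : Matrix _ _ ℂ)

variable (n V) in
/-- A projectively flat structure on `V`: a family of holomorphic trivializations over an open
cover all of whose transition functions are projectively flat. -/
structure ProjFlatAtlas where
  /-- the trivializations of the structure -/
  trivs : Set (HolomorphicTrivialization n V)
  cover : ∀ x : X, ∃ e ∈ trivs, x ∈ e.triv.baseSet
  transition : ∀ e ∈ trivs, ∀ e' ∈ trivs, ProjFlatTransition e e'

/-- A projectively flat trivialization of the projectively flat bundle `(V, 𝒜)`: a holomorphic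
trivialization whose transitions to all members of `𝒜` are projectively flat. -/
def ProjFlatAtlas.IsProjFlat (𝒜 : ProjFlatAtlas n V) (e : HolomorphicTrivialization n V) : Prop :=
  ∀ e' ∈ 𝒜.trivs, ProjFlatTransition e' e

/-- The coordinate vector of the section `A` in the trivialization `e`, as a function of the
coordinate `φ` on the Riemann surface. -/
def localRep (φ : OpenPartialHomeomorph X ℂ) (e : HolomorphicTrivialization n V) (A : ∀ x, V x) :
    ℂ → Fin n → ℂ :=
  fun z => (e.triv ⟨φ.symm z, A (φ.symm z)⟩).2

/-- The section `B` of the projectively flat bundle `(V, 𝒜)` is generic: its Wronskian determinant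
`w(B) = det W(B)`, computed in a holomorphic chart and a projectively flat trivialization, is not
identically zero (as a meromorphic function). -/
def ProjFlatAtlas.IsGeneric (𝒜 : ProjFlatAtlas n V) (B : ∀ x, V x) : Prop :=
  ∃ φ ∈ IsManifold.maximalAtlas 𝓘(ℂ) ω X, ∃ e : HolomorphicTrivialization n V, 𝒜.IsProjFlat e ∧
    ¬ ∀ᶠ z in codiscreteWithin (φ.target ∩ φ.symm ⁻¹' e.triv.baseSet),
      (wronskianMatrix (localRep φ e B) z).det = 0

variable [VectorBundle ℂ (Fin n → ℂ) V]

/-- The Wronskian quotient of `A` by `B` computed in the chart `φ` and the trivialization `e`: at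
a point `x` of their common domain, the endomorphism of the fibre `V x` which in the frame `e` is
the matrix `W(B)⁻¹ W(A)`, acting on row vectors from the right
(thus it sends `B⁽ⁱ⁾` to `A⁽ⁱ⁾` for `i < n`). -/
def localWronskianQuotient (φ : OpenPartialHomeomorph X ℂ) (e : HolomorphicTrivialization n V)
    (A B : ∀ x, V x) (x : X) : V x →L[ℂ] V x :=
  ((e.triv.symmL ℂ x).comp (LinearMap.toContinuousLinearMap (Matrix.vecMulLinear
    ((wronskianMatrix (localRep φ e B) (φ x))⁻¹ * wronskianMatrix (localRep φ e A) (φ x))))).comp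
      (e.triv.continuousLinearMapAt ℂ x)

/-- The Wronskian quotient `A / B` of two sections of the projectively flat bundle `(V, 𝒜)`, a
section of `End V`: at each point `x` it is computed by the local formula in a chart around `x`
and a projectively flat trivialization around `x`. -/
def ProjFlatAtlas.wronskianQuotient (𝒜 : ProjFlatAtlas n V) (A B : ∀ x, V x) (x : X) :
    V x →L[ℂ] V x :=
  localWronskianQuotient (chartAt ℂ x) (𝒜.cover x).choose A B x

/-- The product `P · Q` of sections of `End V`. Endomorphisms act on (row) vectors from the right,
`v (P · Q) = (v P) Q`, so that the product corresponds in every frame to the product of matrices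
in the same order. -/
def endMul (P Q : ∀ x, V x →L[ℂ] V x) (x : X) : V x →L[ℂ] V x := (Q x).comp (P x)

end Bundles

end

/-! Changing the chart by `g` and the projectively flat trivialization by `l • T` turns a coordinate
vector `a` into `l • (a ∘ g)` times `T`. By the Leibniz and chain rules its `i`-th derivative is a
combination of `a ∘ g, …, a⁽ⁱ⁾ ∘ g` whose coefficients depend only on `l` and `g`, while the
constant `T` passes through all derivatives. Hence every Wronskian matrix changes by `W ↦ L * W *
T`, with one `L` for all sections; `L` is lower triangular with diagonal entries `l * g' ^ i`, so it
is invertible (`ProjFlatAtlas.IsProjFlat.exists_wronskianMatrix_eq`).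

In `W(B)⁻¹ * W(A)` the factor `L` cancels and conjugation by `T` remains. This is exactly how an
endomorphism changes between the two frames, since the scalar `l` drops out of a conjugation
(`localWronskianQuotient_eq`). Multiplication of sections by `f` is the case `l = f`, `g = id`, `T =
1`, so it cancels too. The three-term identity telescopes wherever the Wronskian matrices involved
are invertible.

These are pointwise arguments at points where the sections are analytic. Poles are isolated, which
gives the statements off a closed discrete set. That a generic section has invertible Wronskian
matrix off such a set is the identity theorem on a connected surface
(`ProjFlatAtlas.IsGeneric.eventually_regularSectionAt`). -/

/-! ### Wronskian matrices under rescaling, reparametrization and constant matrices. -/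

/-- The coefficients of `f ∘ g, f' ∘ g, f'' ∘ g, …` in the iterated derivatives of `l * (f ∘ g)`. -/
noncomputable def derivSmulCompCoeff (l g : ℂ → ℂ) : ℕ → ℕ → ℂ → ℂ
  | 0, 0 => l
  | 0, _ + 1 => 0
  | i + 1, 0 => deriv (derivSmulCompCoeff l g i 0)
  | i + 1, j + 1 => deriv (derivSmulCompCoeff l g i (j + 1)) +
      derivSmulCompCoeff l g i j * deriv g

theorem derivSmulCompCoeff_of_lt (l g : ℂ → ℂ) :
    ∀ {i j : ℕ}, i < j → derivSmulCompCoeff l g i j = 0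
  | 0, j + 1, _ => rfl
  | i + 1, j + 1, h => by
      rw [derivSmulCompCoeff, derivSmulCompCoeff_of_lt l g (by omega : i < j + 1),
        derivSmulCompCoeff_of_lt l g (by omega : i < j)]
      simp

theorem derivSmulCompCoeff_self (l g : ℂ → ℂ) (i : ℕ) :
    derivSmulCompCoeff l g i i = l * deriv g ^ i := by
  induction i with
  | zero => simp [derivSmulCompCoeff]
  | succ i ih =>
    rw [derivSmulCompCoeff, derivSmulCompCoeff_of_lt l g (Nat.lt_succ_self i), ih, pow_succ]
    simp [mul_assoc]

theorem analyticAt_derivSmulCompCoeff {l g : ℂ → ℂ} {z₀ : ℂ} (hl : AnalyticAt ℂ l z₀)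
    (hg : AnalyticAt ℂ g z₀) : ∀ i j, AnalyticAt ℂ (derivSmulCompCoeff l g i j) z₀
  | 0, 0 => hl
  | 0, _ + 1 => analyticAt_const
  | i + 1, 0 => (analyticAt_derivSmulCompCoeff hl hg i 0).deriv
  | i + 1, j + 1 => (analyticAt_derivSmulCompCoeff hl hg i (j + 1)).deriv.add
      ((analyticAt_derivSmulCompCoeff hl hg i j).mul hg.deriv)

/-- Equality on a neighbourhood, not only at `z₀`, is what lets the induction differentiate the
previous formula. -/
theorem iteratedDeriv_mul_comp_eventuallyEq {l g f : ℂ → ℂ} {z₀ : ℂ} (hl : AnalyticAt ℂ l z₀)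
    (hg : AnalyticAt ℂ g z₀) (hf : AnalyticAt ℂ f (g z₀)) (i : ℕ) :
    iteratedDeriv i (fun z => l z * f (g z)) =ᶠ[𝓝 z₀] fun z =>
      ∑ j ∈ Finset.range (i + 1), derivSmulCompCoeff l g i j z * iteratedDeriv j f (g z) := by
  induction i with
  | zero => exact Eventually.of_forall fun z => by simp [derivSmulCompCoeff]
  | succ i ih =>
    rw [iteratedDeriv_succ]
    refine ih.deriv.trans ?_
    filter_upwards [hl.eventually_analyticAt, hg.eventually_analyticAt,
      hg.continuousAt.eventually hf.eventually_analyticAt] with z hlz hgz hfz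
    have hc := fun j => (analyticAt_derivSmulCompCoeff hlz hgz i j).differentiableAt.hasDerivAt
    have hd : ∀ j, HasDerivAt (fun z => iteratedDeriv j f (g z))
        (iteratedDeriv (j + 1) f (g z) * deriv g z) z := fun j => by
      have := (hfz.iterated_deriv j).differentiableAt.hasDerivAt
      rw [← iteratedDeriv_eq_iterate, ← iteratedDeriv_succ] at this
      exact this.comp z hgz.differentiableAt.hasDerivAt
    have hs := HasDerivAt.fun_sum (u := Finset.range (i + 1)) fun j _ => (hc j).fun_mul (hd j)
    rw [hs.deriv, Finset.sum_add_distrib, Finset.sum_range_succ' _ (i + 1)]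
    -- The added top term has coefficient zero; with it, splitting off `j = 0` leaves two sums over
    -- the same range, and the recursion matches them term by term.
    have h0 : ∑ j ∈ Finset.range (i + 1),
        deriv (derivSmulCompCoeff l g i j) z * iteratedDeriv j f (g z) =
        ∑ j ∈ Finset.range (i + 1 + 1),
        deriv (derivSmulCompCoeff l g i j) z * iteratedDeriv j f (g z) := by
      rw [Finset.sum_range_succ _ (i + 1), derivSmulCompCoeff_of_lt l g (Nat.lt_succ_self i)]
      simp
    rw [h0, Finset.sum_range_succ' _ (i + 1), add_right_comm, ← Finset.sum_add_distrib]
    congr 1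
    refine Finset.sum_congr rfl fun j _ => ?_
    simp only [derivSmulCompCoeff, Pi.add_apply, Pi.mul_apply]
    ring

/-- The matrix relating the Wronskian matrices of `l • (a ∘ g)` and `a`. -/
noncomputable def wronskianTransition (n : ℕ) (l g : ℂ → ℂ) (z : ℂ) : Matrix (Fin n) (Fin n) ℂ :=
  Matrix.of fun i j => derivSmulCompCoeff l g i j z

theorem det_wronskianTransition (n : ℕ) (l g : ℂ → ℂ) (z : ℂ) :
    (wronskianTransition n l g z).det = ∏ i : Fin n, l z * deriv g z ^ (i : ℕ) := by
  rw [Matrix.det_of_isLowerTriangular]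
  · simp [wronskianTransition, derivSmulCompCoeff_self]
  · intro i j hij
    simp [wronskianTransition, derivSmulCompCoeff_of_lt l g (show (i : ℕ) < j from hij)]

theorem isUnit_det_wronskianTransition (n : ℕ) {l g : ℂ → ℂ} {z : ℂ} (hl : l z ≠ 0)
    (hg : deriv g z ≠ 0) : IsUnit (wronskianTransition n l g z).det := by
  rw [det_wronskianTransition, isUnit_iff_ne_zero]
  exact Finset.prod_ne_zero_iff.2 fun i _ => mul_ne_zero hl (pow_ne_zero _ hg)

theorem wronskianMatrix_smul_comp {n : ℕ} {l g : ℂ → ℂ} {a : ℂ → Fin n → ℂ} {z₀ : ℂ}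
    (hl : AnalyticAt ℂ l z₀) (hg : AnalyticAt ℂ g z₀) (ha : AnalyticAt ℂ a (g z₀)) :
    wronskianMatrix (fun z => l z • a (g z)) z₀ =
      wronskianTransition n l g z₀ * wronskianMatrix a (g z₀) := by
  ext i k
  have := (iteratedDeriv_mul_comp_eventuallyEq hl hg (analyticAt_pi_iff.1 ha k) i).self_of_nhds
  simp only [wronskianMatrix, wronskianTransition, Matrix.of_apply, Matrix.mul_apply,
    Pi.smul_apply, smul_eq_mul]
  rw [this, Fin.sum_univ_eq_sum_range
    (fun j => derivSmulCompCoeff l g i j z₀ * iteratedDeriv j (fun w => a w k) (g z₀))]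
  -- Row `i` of the matrix product sums over all `j < n`, but the terms with `j > i` vanish by
  -- triangularity.
  refine Finset.sum_subset (Finset.range_subset_range.2 i.2) fun j _ hj => ?_
  rw [derivSmulCompCoeff_of_lt l g (by simpa using hj)]
  simp

theorem wronskianMatrix_congr {n : ℕ} {a b : ℂ → Fin n → ℂ} {z : ℂ} (h : a =ᶠ[𝓝 z] b) :
    wronskianMatrix a z = wronskianMatrix b z := by
  ext i k
  exact (h.fun_comp (fun v => v k)).iteratedDeriv_eq i

/-- Constancy of `T` is essential here: it is what the flatness of the bundle up to scalars
provides. -/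
theorem wronskianMatrix_vecMul {n : ℕ} {a : ℂ → Fin n → ℂ} {z : ℂ} (ha : AnalyticAt ℂ a z)
    (T : Matrix (Fin n) (Fin n) ℂ) :
    wronskianMatrix (fun w => Matrix.vecMul (a w) T) z = wronskianMatrix a z * T := by
  ext i k
  simp only [wronskianMatrix, Matrix.of_apply, Matrix.mul_apply, Matrix.vecMul, dotProduct]
  rw [iteratedDeriv_fun_sum fun j _ => ((analyticAt_pi_iff.1 ha j).contDiffAt.mul contDiffAt_const)]
  refine Finset.sum_congr rfl fun j _ => ?_
  simp [mul_comm]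

theorem AnalyticAt.vecMul_const {n : ℕ} {a : ℂ → Fin n → ℂ} {z : ℂ} (ha : AnalyticAt ℂ a z)
    (T : Matrix (Fin n) (Fin n) ℂ) : AnalyticAt ℂ (fun w => Matrix.vecMul (a w) T) z :=
  (LinearMap.toContinuousLinearMap (Matrix.vecMulLinear T)).analyticAt _ |>.comp ha

/-! ### Meromorphic vectors, matrices and operators. -/

theorem meromorphicAt_pi_iff {ι : Type*} [Fintype ι] {a : ℂ → ι → ℂ} {z : ℂ} :
    MeromorphicAt a z ↔ ∀ i, MeromorphicAt (fun w => a w i) z := by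
  classical
  refine ⟨fun ⟨k, hk⟩ i => ⟨k, analyticAt_pi_iff.1 hk i⟩, fun h => ?_⟩
  have : a = fun w => ∑ i, a w i • (Pi.single i (1 : ℂ) : ι → ℂ) := by
    ext w j
    simp [Finset.sum_apply, Pi.single_apply]
  rw [this]
  exact MeromorphicAt.fun_sum fun i _ => (h i).smul (MeromorphicAt.const _ _)

theorem MeromorphicAt.matrix_det {n : ℕ} {M : ℂ → Matrix (Fin n) (Fin n) ℂ} {z : ℂ}
    (h : ∀ i j, MeromorphicAt (fun w => M w i j) z) : MeromorphicAt (fun w => (M w).det) z := by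
  simp only [Matrix.det_apply']
  exact MeromorphicAt.fun_sum fun σ _ =>
    (MeromorphicAt.const _ _).mul (MeromorphicAt.fun_prod fun i _ => h _ _)

theorem MeromorphicAt.matrix_mul {n : ℕ} {M N : ℂ → Matrix (Fin n) (Fin n) ℂ} {z : ℂ}
    (hM : ∀ i j, MeromorphicAt (fun w => M w i j) z)
    (hN : ∀ i j, MeromorphicAt (fun w => N w i j) z) (i j : Fin n) :
    MeromorphicAt (fun w => (M w * N w) i j) z := by
  simp only [Matrix.mul_apply]
  exact MeromorphicAt.fun_sum fun k _ => (hM _ _).mul (hN _ _)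

/-- The adjugate formula holds even where the determinant is zero, because both sides are then zero
by convention; no nonvanishing assumption is needed. -/
theorem MeromorphicAt.matrix_inv {n : ℕ} {M : ℂ → Matrix (Fin n) (Fin n) ℂ} {z : ℂ}
    (h : ∀ i j, MeromorphicAt (fun w => M w i j) z) (i j : Fin n) :
    MeromorphicAt (fun w => (M w)⁻¹ i j) z := by
  simp only [Matrix.inv_def, Matrix.smul_apply, Ring.inverse_eq_inv', smul_eq_mul,
    Matrix.adjugate_apply]
  refine (MeromorphicAt.matrix_det h).inv.mul (MeromorphicAt.matrix_det fun k m => ?_)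
  by_cases hk : k = j
  · subst hk
    simp
  · simpa [Matrix.updateRow_ne hk] using h k m

theorem meromorphicAt_wronskianMatrix {n : ℕ} {a : ℂ → Fin n → ℂ} {z : ℂ}
    (ha : MeromorphicAt a z) (i j : Fin n) :
    MeromorphicAt (fun w => wronskianMatrix a w i j) z := by
  simp only [wronskianMatrix, Matrix.of_apply, iteratedDeriv_eq_iterate]
  exact (meromorphicAt_pi_iff.1 ha j).iterated_deriv

/-- A finite-dimensional operator is a combination of fixed rank-one operators, with the matrix
entries as coefficients. -/
theorem meromorphicAt_continuousLinearMap_of_apply_single {n : ℕ}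
    {P : ℂ → (Fin n → ℂ) →L[ℂ] (Fin n → ℂ)} {z : ℂ}
    (h : ∀ i, MeromorphicAt (fun w => P w (Pi.single i 1)) z) : MeromorphicAt P z := by
  have : P = fun w => ∑ i, ∑ j, P w (Pi.single i 1) j •
      (ContinuousLinearMap.proj (R := ℂ) (φ := fun _ : Fin n => ℂ) i).smulRight
        (Pi.single j (1 : ℂ) : Fin n → ℂ) := by
    ext w v j
    conv_lhs => rw [pi_eq_sum_univ' v]
    simp [Finset.sum_apply, Pi.single_apply, mul_comm]
  rw [this]
  exact MeromorphicAt.fun_sum fun i _ => MeromorphicAt.fun_sum fun j _ =>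
    (meromorphicAt_pi_iff.1 (h i) j).smul (MeromorphicAt.const _ _)

/-! ### Transfer of local properties between the surface and its charts. -/

section Charts

variable {X : Type*} [TopologicalSpace X]

theorem eventually_nhds_chart {φ : OpenPartialHomeomorph X ℂ} {x : X} (hx : x ∈ φ.source)
    {p : ℂ → Prop} : (∀ᶠ z in 𝓝 (φ x), p z) ↔ ∀ᶠ y in 𝓝 x, p (φ y) := by
  rw [← φ.map_nhds_eq hx, eventually_map]

theorem eventually_nhds_chart_symm {φ : OpenPartialHomeomorph X ℂ} {x : X} (hx : x ∈ φ.source)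
    {p : X → Prop} : (∀ᶠ z in 𝓝 (φ x), p (φ.symm z)) ↔ ∀ᶠ y in 𝓝 x, p y := by
  rw [eventually_nhds_chart hx]
  refine eventually_congr ?_
  filter_upwards [φ.open_source.mem_nhds hx] with y hy
  rw [φ.left_inv hy]

theorem eventually_nhdsNE_chart {φ : OpenPartialHomeomorph X ℂ} {x : X} (hx : x ∈ φ.source)
    {p : ℂ → Prop} : (∀ᶠ z in 𝓝[≠] (φ x), p z) ↔ ∀ᶠ y in 𝓝[≠] x, p (φ y) := by
  rw [eventually_nhdsWithin_iff, eventually_nhdsWithin_iff, eventually_nhds_chart hx]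
  refine eventually_congr ?_
  filter_upwards [φ.open_source.mem_nhds hx] with y hy
  simp [φ.injOn.eq_iff hy hx]

theorem eventually_nhdsNE_chart_symm {φ : OpenPartialHomeomorph X ℂ} {x : X} (hx : x ∈ φ.source)
    {p : X → Prop} : (∀ᶠ z in 𝓝[≠] (φ x), p (φ.symm z)) ↔ ∀ᶠ y in 𝓝[≠] x, p y := by
  rw [eventually_nhdsNE_chart hx]
  refine eventually_congr ?_
  filter_upwards [nhdsWithin_le_nhds (φ.open_source.mem_nhds hx)] with y hy
  rw [φ.left_inv hy]

theorem eventually_comp_chart_transition {φ φ' : OpenPartialHomeomorph X ℂ} {x : X}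
    (hx : x ∈ φ.source) (hx' : x ∈ φ'.source) :
    ∀ᶠ z in 𝓝 (φ x), φ'.symm (φ' (φ.symm z)) = φ.symm z := by
  filter_upwards [(eventually_nhds_chart_symm hx).2 (φ'.open_source.mem_nhds hx')] with z hz
  exact φ'.left_inv hz

variable [ChartedSpace ℂ X]

theorem analyticAt_comp_chart_symm {E : Type*} [NormedAddCommGroup E] [NormedSpace ℂ E]
    {f : X → E} {φ : OpenPartialHomeomorph X ℂ} (hφ : φ ∈ IsManifold.maximalAtlas 𝓘(ℂ) ω X) {x : X}
    (hx : x ∈ φ.source) (hf : ContMDiffAt 𝓘(ℂ) 𝓘(ℂ, E) ω f x) :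
    AnalyticAt ℂ (fun z => f (φ.symm z)) (φ x) := by
  have hs : ContMDiffAt 𝓘(ℂ) 𝓘(ℂ) ω φ.symm (φ x) :=
    (contMDiffOn_symm_of_mem_maximalAtlas hφ).contMDiffAt
      (φ.open_target.mem_nhds (φ.map_source hx))
  rw [← φ.left_inv hx] at hf
  exact (contMDiffAt_iff_contDiffAt.1 (hf.comp _ hs)).analyticAt

theorem analyticAt_chart_transition {φ φ' : OpenPartialHomeomorph X ℂ}
    (hφ : φ ∈ IsManifold.maximalAtlas 𝓘(ℂ) ω X) (hφ' : φ' ∈ IsManifold.maximalAtlas 𝓘(ℂ) ω X)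
    {x : X} (hx : x ∈ φ.source) (hx' : x ∈ φ'.source) :
    AnalyticAt ℂ (fun z => φ' (φ.symm z)) (φ x) :=
  analyticAt_comp_chart_symm hφ hx (contMDiffAt_of_mem_maximalAtlas hφ' hx')

variable (X) in
theorem neBot_nhdsNE_of_chartedSpace (x : X) : (𝓝[≠] x).NeBot := by
  by_contra h
  have : ∀ᶠ y in 𝓝[≠] x, False := by simp [not_neBot.1 h]
  have := (eventually_nhdsNE_chart (mem_chart_source ℂ x) (p := fun _ => False)).2 this
  exact this.exists.elim fun _ h => h

/-- The reverse transition is a holomorphic inverse, so the chain rule makes the product of the two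
derivatives equal to `1`. -/
theorem deriv_chart_transition_ne_zero {φ φ' : OpenPartialHomeomorph X ℂ}
    (hφ : φ ∈ IsManifold.maximalAtlas 𝓘(ℂ) ω X) (hφ' : φ' ∈ IsManifold.maximalAtlas 𝓘(ℂ) ω X)
    {x : X} (hx : x ∈ φ.source) (hx' : x ∈ φ'.source) :
    deriv (fun z => φ' (φ.symm z)) (φ x) ≠ 0 := by
  intro h0
  have h1 := (analyticAt_chart_transition hφ hφ' hx hx').differentiableAt.hasDerivAt
  have h2 : HasDerivAt (fun z => φ (φ'.symm z)) (deriv (fun z => φ (φ'.symm z)) (φ' x))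
      (φ' (φ.symm (φ x))) := by
    rw [φ.left_inv hx]
    exact (analyticAt_chart_transition hφ' hφ hx' hx).differentiableAt.hasDerivAt
  have h3 := h2.comp (h := fun z => φ' (φ.symm z)) (φ x) h1
  have h4 : (fun z => φ (φ'.symm z)) ∘ (fun z => φ' (φ.symm z)) =ᶠ[𝓝 (φ x)] id := by
    filter_upwards [(eventually_nhds_chart_symm hx).2 (φ'.open_source.mem_nhds hx'),
      φ.open_target.mem_nhds (φ.map_source hx)] with z hz hz'
    simp [φ'.left_inv hz, φ.right_inv hz']
  have := (h3.congr_of_eventuallyEq h4.symm).unique (hasDerivAt_id _)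
  simp [h0] at this

theorem MeromorphicAt.chart_transition {E : Type*} [NormedAddCommGroup E] [NormedSpace ℂ E]
    {f : ℂ → E} {φ φ' : OpenPartialHomeomorph X ℂ}
    (hφ : φ ∈ IsManifold.maximalAtlas 𝓘(ℂ) ω X) (hφ' : φ' ∈ IsManifold.maximalAtlas 𝓘(ℂ) ω X)
    {x : X} (hx : x ∈ φ.source) (hx' : x ∈ φ'.source) (hf : MeromorphicAt f (φ' x)) :
    MeromorphicAt (fun z => f (φ' (φ.symm z))) (φ x) := by
  rw [← φ.left_inv hx] at hf
  exact hf.comp_analyticAt (g := fun z => φ' (φ.symm z)) (analyticAt_chart_transition hφ hφ' hx hx')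

theorem AnalyticAt.chart_transition {E : Type*} [NormedAddCommGroup E] [NormedSpace ℂ E]
    {f : ℂ → E} {φ φ' : OpenPartialHomeomorph X ℂ}
    (hφ : φ ∈ IsManifold.maximalAtlas 𝓘(ℂ) ω X) (hφ' : φ' ∈ IsManifold.maximalAtlas 𝓘(ℂ) ω X)
    {x : X} (hx : x ∈ φ.source) (hx' : x ∈ φ'.source) (hf : AnalyticAt ℂ f (φ' x)) :
    AnalyticAt ℂ (fun z => f (φ' (φ.symm z))) (φ x) := by
  rw [← φ.left_inv hx] at hf
  exact hf.comp (f := fun z => φ' (φ.symm z)) (analyticAt_chart_transition hφ hφ' hx hx')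

theorem analyticAt_function_of_chart {f : X → ℂ} {φ φ' : OpenPartialHomeomorph X ℂ}
    (hφ : φ ∈ IsManifold.maximalAtlas 𝓘(ℂ) ω X) (hφ' : φ' ∈ IsManifold.maximalAtlas 𝓘(ℂ) ω X)
    {x : X} (hx : x ∈ φ.source) (hx' : x ∈ φ'.source)
    (hf : AnalyticAt ℂ (fun z => f (φ'.symm z)) (φ' x)) :
    AnalyticAt ℂ (fun z => f (φ.symm z)) (φ x) := by
  refine (hf.chart_transition hφ hφ' hx hx').congr ?_
  filter_upwards [eventually_comp_chart_transition hx hx'] with z hz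
  rw [hz]

variable [IsManifold 𝓘(ℂ) ω X]

theorem IsMeromorphicFunction.eventually_analyticAt {f : X → ℂ} (hf : IsMeromorphicFunction f)
    (x : X) : ∀ᶠ y in 𝓝[≠] x,
      AnalyticAt ℂ (fun z => f ((chartAt ℂ y).symm z)) (chartAt ℂ y y) := by
  have h := (hf x).eventually_analyticAt
  rw [eventually_nhdsNE_chart (mem_chart_source ℂ x)] at h
  filter_upwards [h, nhdsWithin_le_nhds ((chartAt ℂ x).open_source.mem_nhds
    (mem_chart_source ℂ x))] with y hy hyx
  exact analyticAt_function_of_chart (IsManifold.chart_mem_maximalAtlas y)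
    (IsManifold.chart_mem_maximalAtlas x) (mem_chart_source ℂ y) hyx hy

end Charts

/-! ### Identity theorem for isolated exceptional points. -/

/-- An open-closed dichotomy: a property which near every point either holds or fails on a punctured
neighbourhood holds on all punctured neighbourhoods as soon as it does not fail around one point. -/
theorem forall_eventually_nhdsNE_of_dichotomy {X : Type*} [TopologicalSpace X] [T1Space X]
    [PreconnectedSpace X] (hne : ∀ x : X, (𝓝[≠] x).NeBot) {p : X → Prop}
    (h : ∀ x, (∀ᶠ y in 𝓝[≠] x, p y) ∨ ∀ᶠ y in 𝓝[≠] x, ¬ p y)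
    (hex : ∃ x, ¬ ∀ᶠ y in 𝓝[≠] x, ¬ p y) (x : X) : ∀ᶠ y in 𝓝[≠] x, p y := by
  -- Absence of isolated points makes the two alternatives exclusive. Both loci are open, hence each
  -- is clopen.
  have hcompl : {x | ∀ᶠ y in 𝓝[≠] x, p y}ᶜ = {x | ∀ᶠ y in 𝓝[≠] x, ¬ p y} := by
    ext y
    simp only [Set.mem_compl_iff, Set.mem_ofPred_eq]
    refine ⟨fun hy => (h y).resolve_left hy, fun hy hy' => ?_⟩
    obtain ⟨z, hz, hz'⟩ := (hy.and hy').exists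
    exact hz hz'
  have hclopen : IsClopen {x | ∀ᶠ y in 𝓝[≠] x, p y} :=
    ⟨⟨hcompl ▸ isOpen_setOfPred_eventually_nhdsWithin⟩, isOpen_setOfPred_eventually_nhdsWithin⟩
  obtain ⟨x₀, hx₀⟩ := hex
  exact Set.eq_univ_iff_forall.1 (hclopen.eq_univ ⟨x₀, (h x₀).resolve_right hx₀⟩) x

theorem eventually_codiscreteWithin_of_forall_nhdsNE {X : Type*} [TopologicalSpace X] {S : Set X}
    {p : X → Prop} (h : ∀ x ∈ S, ∀ᶠ y in 𝓝[≠] x, p y) : ∀ᶠ x in codiscreteWithin S, p x :=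
  mem_codiscreteWithin_iff_forall_mem_nhdsNE.2 fun x hx => mem_of_superset (h x hx) fun _ => Or.inl

theorem IsMeromorphicFunction.eventually_ne_zero {X : Type*} [TopologicalSpace X] [T1Space X]
    [PreconnectedSpace X] [ChartedSpace ℂ X] {f : X → ℂ}
    (hf : IsMeromorphicFunction f) (hne : ¬ ∀ᶠ x in codiscrete X, f x = 0) (x : X) :
    ∀ᶠ y in 𝓝[≠] x, f y ≠ 0 := by
  refine forall_eventually_nhdsNE_of_dichotomy (neBot_nhdsNE_of_chartedSpace X) (fun x => ?_) ?_ x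
  · rcases (hf x).eventually_eq_zero_or_eventually_ne_zero with h | h
    · exact Or.inr (by simpa using (eventually_nhdsNE_chart_symm (mem_chart_source ℂ x)).1 h)
    · exact Or.inl ((eventually_nhdsNE_chart_symm (p := fun y => f y ≠ 0)
        (mem_chart_source ℂ x)).1 h)
  · by_contra! hcon
    exact hne (eventually_codiscreteWithin_of_forall_nhdsNE fun x _ => by simpa using hcon x)

/-! ### Changes of holomorphic and of projectively flat frames. -/

section Bundles

variable {X : Type*} [TopologicalSpace X] [ChartedSpace ℂ X]
  {n : ℕ} {V : X → Type*} [TopologicalSpace (TotalSpace (Fin n → ℂ) V)]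
  [∀ x, TopologicalSpace (V x)] [∀ x, AddCommGroup (V x)] [∀ x, Module ℂ (V x)]
  [FiberBundle (Fin n → ℂ) V]

/-- The matrix of the change of frame from `e` to `e'`, acting on row vectors from the right. -/
noncomputable def frameTransition (e e' : HolomorphicTrivialization n V) (y : X) :
    Matrix (Fin n) (Fin n) ℂ :=
  Matrix.of fun i => (e'.triv ⟨y, e.triv.symm y (Pi.single i 1)⟩).2

theorem snd_apply_symm_eq_vecMul (e e' : HolomorphicTrivialization n V) {y : X}
    (hy : y ∈ e.triv.baseSet) (hy' : y ∈ e'.triv.baseSet) (v : Fin n → ℂ) :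
    (e'.triv ⟨y, e.triv.symm y v⟩).2 = Matrix.vecMul v (frameTransition e e' y) := by
  have h : (e'.triv.linear ℂ hy').mk' _ ∘ₗ e.triv.symmₗ ℂ y =
      Matrix.vecMulLinear (frameTransition e e' y) := by
    refine (Pi.basisFun ℂ (Fin n)).ext fun i => ?_
    ext j
    simp [frameTransition, e.triv.coe_symmₗ hy]
  simpa [e.triv.coe_symmₗ hy] using LinearMap.congr_fun h v

theorem snd_apply_eq_vecMul (e e' : HolomorphicTrivialization n V) {y : X}
    (hy : y ∈ e.triv.baseSet) (hy' : y ∈ e'.triv.baseSet) (v : V y) :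
    (e'.triv ⟨y, v⟩).2 = Matrix.vecMul (e.triv ⟨y, v⟩).2 (frameTransition e e' y) := by
  rw [← snd_apply_symm_eq_vecMul e e' hy hy', e.triv.symm_apply_apply_mk hy]

theorem contMDiffAt_frameTransition (e e' : HolomorphicTrivialization n V) {x : X}
    (hx : x ∈ e.triv.baseSet) (hx' : x ∈ e'.triv.baseSet) (v : Fin n → ℂ) :
    ContMDiffAt 𝓘(ℂ) 𝓘(ℂ, Fin n → ℂ) ω (fun y => (e'.triv ⟨y, e.triv.symm y v⟩).2) x := by
  have h1 : ContMDiffAt 𝓘(ℂ) (𝓘(ℂ).prod 𝓘(ℂ, Fin n → ℂ)) ω (fun y : X => (y, v)) x :=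
    contMDiffAt_id.prodMk contMDiffAt_const
  have h2 := (e.holomorphic_symm.contMDiffAt (e.triv.open_target.mem_nhds
    (e.triv.mem_target.2 hx : (x, v) ∈ _))).comp x h1
  have h3 : ContMDiffAt 𝓘(ℂ) (𝓘(ℂ).prod 𝓘(ℂ, Fin n → ℂ)) ω
      (fun y : X => (⟨y, e.triv.symm y v⟩ : TotalSpace (Fin n → ℂ) V)) x := by
    refine h2.congr_of_eventuallyEq ?_
    filter_upwards [e.triv.open_baseSet.mem_nhds hx] with y hy
    exact e.triv.mk_symm hy v
  have h4 := (e'.holomorphic.contMDiffAt (e'.triv.open_source.mem_nhds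
    (e'.triv.mem_source.2 hx' :
      (⟨x, e.triv.symm x v⟩ : TotalSpace (Fin n → ℂ) V) ∈ _))).comp x h3
  exact contMDiffAt_snd.comp x h4

theorem analyticAt_frameTransition (e e' : HolomorphicTrivialization n V)
    {φ : OpenPartialHomeomorph X ℂ} (hφ : φ ∈ IsManifold.maximalAtlas 𝓘(ℂ) ω X) {x : X}
    (hxφ : x ∈ φ.source) (hx : x ∈ e.triv.baseSet) (hx' : x ∈ e'.triv.baseSet) (i j : Fin n) :
    AnalyticAt ℂ (fun z => frameTransition e e' (φ.symm z) i j) (φ x) :=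
  analyticAt_pi_iff.1 (analyticAt_comp_chart_symm hφ hxφ
    (contMDiffAt_frameTransition e e' hx hx' (Pi.single i 1))) j

/-- Coordinates change by a matrix with holomorphic entries after a holomorphic change of variable,
and both operations preserve meromorphy. -/
theorem meromorphicAt_localRep_of_meromorphicAt {A : ∀ x, V x}
    (e e' : HolomorphicTrivialization n V) {φ φ' : OpenPartialHomeomorph X ℂ}
    (hφ : φ ∈ IsManifold.maximalAtlas 𝓘(ℂ) ω X) (hφ' : φ' ∈ IsManifold.maximalAtlas 𝓘(ℂ) ω X)
    {x : X} (hxφ : x ∈ φ.source) (hxφ' : x ∈ φ'.source)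
    (hx : x ∈ e.triv.baseSet) (hx' : x ∈ e'.triv.baseSet)
    (h : MeromorphicAt (localRep φ' e' A) (φ' x)) : MeromorphicAt (localRep φ e A) (φ x) := by
  have h1 : MeromorphicAt (fun z => Matrix.vecMul (localRep φ' e' A (φ' (φ.symm z)))
      (frameTransition e' e (φ.symm z))) (φ x) :=
    meromorphicAt_pi_iff.2 fun j => MeromorphicAt.fun_sum fun i _ =>
      (meromorphicAt_pi_iff.1 (h.chart_transition hφ hφ' hxφ hxφ') i).mul
        (analyticAt_frameTransition e' e hφ hxφ hx' hx i j).meromorphicAt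
  refine h1.congr (Filter.Eventually.filter_mono nhdsWithin_le_nhds ?_)
  filter_upwards [eventually_comp_chart_transition hxφ hxφ',
    (eventually_nhds_chart_symm hxφ).2 (e.triv.open_baseSet.mem_nhds hx),
    (eventually_nhds_chart_symm hxφ).2 (e'.triv.open_baseSet.mem_nhds hx')] with z hz hze hze'
  simp only [localRep]
  rw [hz, ← snd_apply_eq_vecMul e' e hze' hze]

variable (n V) in
/-- The preferred trivialization at `x` of a holomorphic vector bundle. -/
noncomputable def holomorphicTrivializationAt [VectorBundle ℂ (Fin n → ℂ) V]
    [ContMDiffVectorBundle ω (Fin n → ℂ) V 𝓘(ℂ)] (x : X) : HolomorphicTrivialization n V where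
  triv := trivializationAt (Fin n → ℂ) V x
  isLinear := inferInstance
  holomorphic := Trivialization.contMDiffOn _
  holomorphic_symm := Trivialization.contMDiffOn_symm _

theorem IsMeromorphicSection.meromorphicAt_localRep [IsManifold 𝓘(ℂ) ω X]
    [VectorBundle ℂ (Fin n → ℂ) V]
    [ContMDiffVectorBundle ω (Fin n → ℂ) V 𝓘(ℂ)] {A : ∀ x, V x}
    (hA : IsMeromorphicSection (Fin n → ℂ) V A) {φ : OpenPartialHomeomorph X ℂ}
    (hφ : φ ∈ IsManifold.maximalAtlas 𝓘(ℂ) ω X) (e : HolomorphicTrivialization n V) {x : X}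
    (hxφ : x ∈ φ.source) (hx : x ∈ e.triv.baseSet) : MeromorphicAt (localRep φ e A) (φ x) :=
  meromorphicAt_localRep_of_meromorphicAt e (holomorphicTrivializationAt n V x) hφ
    (IsManifold.chart_mem_maximalAtlas x) hxφ (mem_chart_source ℂ x) hx
    (mem_baseSet_trivializationAt (Fin n → ℂ) V x) (hA x)

/-! ### Projectively flat trivializations -/

/-- Between projectively flat trivializations, coordinates change by a holomorphic factor times a
constant matrix near every common point. -/
theorem ProjFlatAtlas.IsProjFlat.exists_transition {𝒜 : ProjFlatAtlas n V}
    {e e' : HolomorphicTrivialization n V} (he : 𝒜.IsProjFlat e) (he' : 𝒜.IsProjFlat e') {x : X}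
    (hx : x ∈ e.triv.baseSet) (hx' : x ∈ e'.triv.baseSet) :
    ∃ (T : GL (Fin n) ℂ) (l : X → ℂ), ContMDiffAt 𝓘(ℂ) 𝓘(ℂ) ω l x ∧ l x ≠ 0 ∧
      ∀ᶠ y in 𝓝 x, ∀ v : V y,
        (e.triv ⟨y, v⟩).2 = l y • Matrix.vecMul (e'.triv ⟨y, v⟩).2 (T : Matrix _ _ ℂ) := by
  -- Projective flatness compares a trivialization only with members of the atlas, so the transition
  -- from `e'` to `e` is factored through a member `e₀`; this yields the constant matrix `T'⁻¹ * T`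
  -- and the scalar `l / l'`.
  obtain ⟨e₀, he₀, hx₀⟩ := 𝒜.cover x
  obtain ⟨T, l, hl, hT⟩ := he e₀ he₀
  obtain ⟨T', l', hl', hT'⟩ := he' e₀ he₀
  have hb := e.triv.open_baseSet
  have hb' := e'.triv.open_baseSet
  have hb₀ := e₀.triv.open_baseSet
  have hlx := (hT x ⟨hx₀, hx⟩).1
  have hlx' := (hT' x ⟨hx₀, hx'⟩).1
  refine ⟨T'⁻¹ * T, fun y => l y / l' y,
    (hl.contMDiffAt ((hb₀.inter hb).mem_nhds ⟨hx₀, hx⟩)).div₀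
      (hl'.contMDiffAt ((hb₀.inter hb').mem_nhds ⟨hx₀, hx'⟩)) hlx',
    div_ne_zero hlx hlx', ?_⟩
  filter_upwards [hb.mem_nhds hx, hb'.mem_nhds hx', hb₀.mem_nhds hx₀] with y hy hy' hy₀ v
  have hn := (hT' y ⟨hy₀, hy'⟩).1
  rw [(hT y ⟨hy₀, hy⟩).2, (hT' y ⟨hy₀, hy'⟩).2, Matrix.smul_vecMul, smul_smul,
    div_mul_cancel₀ _ hn, Matrix.vecMul_vecMul, Units.val_mul, ← mul_assoc, ← Units.val_mul]
  simp

/-- The transformation of Wronskian matrices under a change of chart and of projectively flat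
trivialization: the matrices `L` and `T` are the same for all sections. -/
theorem ProjFlatAtlas.IsProjFlat.exists_wronskianMatrix_eq {𝒜 : ProjFlatAtlas n V}
    {e e' : HolomorphicTrivialization n V} (he : 𝒜.IsProjFlat e) (he' : 𝒜.IsProjFlat e')
    {φ φ' : OpenPartialHomeomorph X ℂ}
    (hφ : φ ∈ IsManifold.maximalAtlas 𝓘(ℂ) ω X) (hφ' : φ' ∈ IsManifold.maximalAtlas 𝓘(ℂ) ω X)
    {x : X} (hxφ : x ∈ φ.source) (hxφ' : x ∈ φ'.source)
    (hx : x ∈ e.triv.baseSet) (hx' : x ∈ e'.triv.baseSet) :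
    ∃ (L T : Matrix (Fin n) (Fin n) ℂ) (c : ℂ), IsUnit L.det ∧ IsUnit T.det ∧
      (∀ v : V x, (e.triv ⟨x, v⟩).2 = c • Matrix.vecMul (e'.triv ⟨x, v⟩).2 T) ∧
      ∀ A : ∀ x, V x, AnalyticAt ℂ (localRep φ' e' A) (φ' x) →
        AnalyticAt ℂ (localRep φ e A) (φ x) ∧
        wronskianMatrix (localRep φ e A) (φ x) =
          L * wronskianMatrix (localRep φ' e' A) (φ' x) * T := by
  obtain ⟨T, l, hl, hlx, hT⟩ := he.exists_transition he' hx hx'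
  have hla := analyticAt_comp_chart_symm hφ hxφ hl
  have hg := analyticAt_chart_transition hφ hφ' hxφ hxφ'
  have hgx : φ' (φ.symm (φ x)) = φ' x := by rw [φ.left_inv hxφ]
  refine ⟨wronskianTransition n (fun z => l (φ.symm z)) (fun z => φ' (φ.symm z)) (φ x), T, l x,
    isUnit_det_wronskianTransition n (by rwa [φ.left_inv hxφ])
      (deriv_chart_transition_ne_zero hφ hφ' hxφ hxφ'),
    (Matrix.isUnit_iff_isUnit_det _).1 T.isUnit, hT.self_of_nhds, fun A hA => ?_⟩
  have hA' : AnalyticAt ℂ (localRep φ' e' A) (φ' (φ.symm (φ x))) := by rwa [hgx]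
  have hloc : localRep φ e A =ᶠ[𝓝 (φ x)] fun z =>
      Matrix.vecMul (l (φ.symm z) • localRep φ' e' A (φ' (φ.symm z))) (T : Matrix _ _ ℂ) := by
    filter_upwards [eventually_comp_chart_transition hxφ hxφ',
      (eventually_nhds_chart_symm hxφ).2 hT] with z hz hzT
    simp only [localRep]
    rw [hz, hzT, Matrix.smul_vecMul]
  have ha : AnalyticAt ℂ (fun z => l (φ.symm z) • localRep φ' e' A (φ' (φ.symm z))) (φ x) :=
    hla.smul (hA.chart_transition hφ hφ' hxφ hxφ')
  refine ⟨(ha.vecMul_const _).congr hloc.symm, ?_⟩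
  rw [wronskianMatrix_congr hloc, wronskianMatrix_vecMul ha,
    wronskianMatrix_smul_comp (a := localRep φ' e' A) hla hg hA', hgx]

end Bundles

/-! ### Analytic and regular points, and the global quotient. -/

section Regular

variable {X : Type*} [TopologicalSpace X] [ChartedSpace ℂ X]
  {n : ℕ} {V : X → Type*} [TopologicalSpace (TotalSpace (Fin n → ℂ) V)]
  [∀ x, TopologicalSpace (V x)] [∀ x, AddCommGroup (V x)] [∀ x, Module ℂ (V x)]
  [FiberBundle (Fin n → ℂ) V] (𝒜 : ProjFlatAtlas n V)

/-- The chosen projectively flat trivialization around `x`. -/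
noncomputable def ProjFlatAtlas.trivAt (x : X) : HolomorphicTrivialization n V :=
  (𝒜.cover x).choose

theorem ProjFlatAtlas.isProjFlat_of_mem {𝒜 : ProjFlatAtlas n V} {e : HolomorphicTrivialization n V}
    (he : e ∈ 𝒜.trivs) : 𝒜.IsProjFlat e := fun e' he' => 𝒜.transition e' he' e he

theorem ProjFlatAtlas.isProjFlat_trivAt (x : X) : 𝒜.IsProjFlat (𝒜.trivAt x) :=
  isProjFlat_of_mem (𝒜.cover x).choose_spec.1

theorem ProjFlatAtlas.mem_baseSet_trivAt (x : X) : x ∈ (𝒜.trivAt x).triv.baseSet :=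
  (𝒜.cover x).choose_spec.2

/-- The section `A` is analytic at `x`. -/
def ProjFlatAtlas.AnalyticSectionAt (A : ∀ x, V x) (x : X) : Prop :=
  AnalyticAt ℂ (localRep (chartAt ℂ x) (𝒜.trivAt x) A) (chartAt ℂ x x)

/-- The section `B` is analytic at `x` and its Wronskian determinant does not vanish there. -/
def ProjFlatAtlas.RegularSectionAt (B : ∀ x, V x) (x : X) : Prop :=
  𝒜.AnalyticSectionAt B x ∧
    (wronskianMatrix (localRep (chartAt ℂ x) (𝒜.trivAt x) B) (chartAt ℂ x x)).det ≠ 0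

/-- Multiplication of sections by an analytic nonvanishing function multiplies all Wronskian
matrices from the left by a common invertible matrix. -/
theorem exists_wronskianMatrix_localRep_smul {f : X → ℂ} {φ : OpenPartialHomeomorph X ℂ}
    (e : HolomorphicTrivialization n V) {x : X} (hxφ : x ∈ φ.source) (hx : x ∈ e.triv.baseSet)
    (hf : AnalyticAt ℂ (fun z => f (φ.symm z)) (φ x)) (hfx : f x ≠ 0) :
    ∃ L : Matrix (Fin n) (Fin n) ℂ, IsUnit L.det ∧ ∀ A : ∀ x, V x,
      AnalyticAt ℂ (localRep φ e A) (φ x) →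
        AnalyticAt ℂ (localRep φ e (fun y => f y • A y)) (φ x) ∧
        wronskianMatrix (localRep φ e (fun y => f y • A y)) (φ x) =
          L * wronskianMatrix (localRep φ e A) (φ x) := by
  refine ⟨wronskianTransition n (fun z => f (φ.symm z)) (fun z => z) (φ x),
    isUnit_det_wronskianTransition n (by rwa [φ.left_inv hxφ]) (by simp), fun A hA => ?_⟩
  have hloc : localRep φ e (fun y => f y • A y) =ᶠ[𝓝 (φ x)]
      fun z => f (φ.symm z) • localRep φ e A z := by
    filter_upwards [(eventually_nhds_chart_symm hxφ).2 (e.triv.open_baseSet.mem_nhds hx)] with z hz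
    exact (e.triv.linear ℂ hz).map_smul _ _
  refine ⟨(hf.smul hA).congr hloc.symm, ?_⟩
  rw [wronskianMatrix_congr hloc]
  exact wronskianMatrix_smul_comp (g := fun z => z) hf analyticAt_id hA

theorem ProjFlatAtlas.RegularSectionAt.smul {𝒜 : ProjFlatAtlas n V} {B : ∀ x, V x} {f : X → ℂ}
    {x : X} (hB : 𝒜.RegularSectionAt B x)
    (hf : AnalyticAt ℂ (fun z => f ((chartAt ℂ x).symm z)) (chartAt ℂ x x)) (hfx : f x ≠ 0) :
    𝒜.RegularSectionAt (fun x => f x • B x) x := by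
  obtain ⟨L, hL, hW⟩ := exists_wronskianMatrix_localRep_smul (𝒜.trivAt x)
    (mem_chart_source ℂ x) (𝒜.mem_baseSet_trivAt x) hf hfx
  refine ⟨(hW B hB.1).1, ?_⟩
  rw [(hW B hB.1).2, Matrix.det_mul]
  exact mul_ne_zero hL.ne_zero hB.2

theorem snd_apply_localWronskianQuotient (φ : OpenPartialHomeomorph X ℂ)
    (e : HolomorphicTrivialization n V) (A B : ∀ x, V x) {x : X} (hx : x ∈ e.triv.baseSet)
    (v : V x) :
    (e.triv ⟨x, localWronskianQuotient φ e A B x v⟩).2 =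
      Matrix.vecMul (e.triv ⟨x, v⟩).2 ((wronskianMatrix (localRep φ e B) (φ x))⁻¹ *
        wronskianMatrix (localRep φ e A) (φ x)) := by
  simp [localWronskianQuotient, e.triv.coe_linearMapAt_of_mem hx, e.triv.apply_mk_symm hx,
    e.triv.symmL_apply hx]

theorem HolomorphicTrivialization.ext_snd (e : HolomorphicTrivialization n V) {x : X}
    (hx : x ∈ e.triv.baseSet) {v w : V x} (h : (e.triv ⟨x, v⟩).2 = (e.triv ⟨x, w⟩).2) : v = w := by
  rw [← e.triv.symm_apply_apply_mk hx v, h, e.triv.symm_apply_apply_mk hx]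

/-- The local formula is independent of the chart and of the projectively flat trivialization at
all points where both sections are analytic. -/
theorem localWronskianQuotient_eq {𝒜 : ProjFlatAtlas n V}
    {e e' : HolomorphicTrivialization n V} (he : 𝒜.IsProjFlat e) (he' : 𝒜.IsProjFlat e')
    {φ φ' : OpenPartialHomeomorph X ℂ}
    (hφ : φ ∈ IsManifold.maximalAtlas 𝓘(ℂ) ω X) (hφ' : φ' ∈ IsManifold.maximalAtlas 𝓘(ℂ) ω X)
    {x : X} (hxφ : x ∈ φ.source) (hxφ' : x ∈ φ'.source)
    (hx : x ∈ e.triv.baseSet) (hx' : x ∈ e'.triv.baseSet) {A B : ∀ x, V x}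
    (hA : AnalyticAt ℂ (localRep φ' e' A) (φ' x)) (hB : AnalyticAt ℂ (localRep φ' e' B) (φ' x)) :
    localWronskianQuotient φ e A B x = localWronskianQuotient φ' e' A B x := by
  obtain ⟨L, T, c, hL, hT, hv, hW⟩ := he.exists_wronskianMatrix_eq he' hφ hφ' hxφ hxφ' hx hx'
  refine ContinuousLinearMap.ext fun v => e.ext_snd hx ?_
  rw [snd_apply_localWronskianQuotient φ e A B hx, hv (localWronskianQuotient φ' e' A B x v),
    snd_apply_localWronskianQuotient φ' e' A B hx', hv v, (hW A hA).2, (hW B hB).2,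
    Matrix.smul_vecMul, Matrix.vecMul_vecMul, Matrix.vecMul_vecMul, Matrix.mul_inv_rev,
    Matrix.mul_inv_rev]
  -- After the scalar `c` is matched, what remains is `T * (T⁻¹ * W(B)⁻¹ * L⁻¹) * (L * W(A) * T) =
  -- W(B)⁻¹ * W(A) * T`. Reversing the inverse of a product is valid for the total matrix inverse,
  -- so only `L` and `T` have to be invertible.
  congr 2
  simp only [← Matrix.mul_assoc]
  rw [Matrix.mul_nonsing_inv _ hT, Matrix.one_mul, Matrix.mul_assoc _ L⁻¹ L,
    Matrix.nonsing_inv_mul _ hL, Matrix.mul_one]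

theorem IsMeromorphicSection.smul [VectorBundle ℂ (Fin n → ℂ) V] {A : ∀ x, V x}
    (hA : IsMeromorphicSection (Fin n → ℂ) V A)
    {f : X → ℂ} (hf : IsMeromorphicFunction f) :
    IsMeromorphicSection (Fin n → ℂ) V (fun x => f x • A x) := by
  intro x
  refine ((hf x).smul (hA x)).congr (Filter.Eventually.filter_mono nhdsWithin_le_nhds ?_)
  filter_upwards [(eventually_nhds_chart_symm (mem_chart_source ℂ x)).2
    ((trivializationAt (Fin n → ℂ) V x).open_baseSet.mem_nhds
      (mem_baseSet_trivializationAt (Fin n → ℂ) V x))] with z hz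
  exact (((trivializationAt (Fin n → ℂ) V x).linear ℂ hz).map_smul _ _).symm

theorem ProjFlatAtlas.endMul_wronskianQuotient_eq_id {A B C : ∀ x, V x} {x : X}
    (hA : 𝒜.RegularSectionAt A x) (hB : 𝒜.RegularSectionAt B x) (hC : 𝒜.RegularSectionAt C x) :
    endMul (endMul (𝒜.wronskianQuotient A B) (𝒜.wronskianQuotient C A))
      (𝒜.wronskianQuotient B C) x = ContinuousLinearMap.id ℂ (V x) := by
  have hx := 𝒜.mem_baseSet_trivAt x
  refine ContinuousLinearMap.ext fun v => (𝒜.trivAt x).ext_snd hx ?_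
  have key : ∀ (A B : ∀ x, V x) (v : V x), _ := fun A B v =>
    snd_apply_localWronskianQuotient (chartAt ℂ x) (𝒜.trivAt x) A B hx v
  change ((𝒜.trivAt x).triv ⟨x, localWronskianQuotient (chartAt ℂ x) (𝒜.trivAt x) B C x
    (localWronskianQuotient (chartAt ℂ x) (𝒜.trivAt x) C A x
      (localWronskianQuotient (chartAt ℂ x) (𝒜.trivAt x) A B x v))⟩).2 =
    ((𝒜.trivAt x).triv ⟨x, v⟩).2
  -- In row-vector order the product is `W(B)⁻¹ W(A) · W(A)⁻¹ W(C) · W(C)⁻¹ W(B)`, which telescopes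
  -- from the inside.
  rw [key, key, key, Matrix.vecMul_vecMul, Matrix.vecMul_vecMul]
  simp only [← Matrix.mul_assoc]
  rw [Matrix.mul_nonsing_inv_cancel_right _ _ hA.2.isUnit,
    Matrix.mul_nonsing_inv_cancel_right _ _ hC.2.isUnit, Matrix.nonsing_inv_mul _ hB.2.isUnit,
    Matrix.vecMul_one]

theorem ProjFlatAtlas.wronskianQuotient_smul {A B : ∀ x, V x} {f : X → ℂ} {x : X}
    (hA : 𝒜.AnalyticSectionAt A x) (hB : 𝒜.AnalyticSectionAt B x)
    (hf : AnalyticAt ℂ (fun z => f ((chartAt ℂ x).symm z)) (chartAt ℂ x x)) (hfx : f x ≠ 0) :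
    𝒜.wronskianQuotient (fun x => f x • A x) (fun x => f x • B x) x =
      𝒜.wronskianQuotient A B x := by
  have hx := 𝒜.mem_baseSet_trivAt x
  obtain ⟨L, hL, hW⟩ := exists_wronskianMatrix_localRep_smul (𝒜.trivAt x)
    (mem_chart_source ℂ x) hx hf hfx
  change localWronskianQuotient (chartAt ℂ x) (𝒜.trivAt x) _ _ x =
    localWronskianQuotient (chartAt ℂ x) (𝒜.trivAt x) _ _ x
  refine ContinuousLinearMap.ext fun v => (𝒜.trivAt x).ext_snd hx ?_
  rw [snd_apply_localWronskianQuotient _ _ _ _ hx, snd_apply_localWronskianQuotient _ _ _ _ hx,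
    (hW A hA).2, (hW B hB).2, Matrix.mul_inv_rev, Matrix.mul_assoc _ L⁻¹, ← Matrix.mul_assoc L⁻¹,
    Matrix.nonsing_inv_mul _ hL, Matrix.one_mul]

variable [IsManifold 𝓘(ℂ) ω X]

variable {𝒜} in
theorem ProjFlatAtlas.IsProjFlat.analyticSectionAt_iff {e : HolomorphicTrivialization n V}
    (he : 𝒜.IsProjFlat e) {φ : OpenPartialHomeomorph X ℂ}
    (hφ : φ ∈ IsManifold.maximalAtlas 𝓘(ℂ) ω X) {x : X} (hxφ : x ∈ φ.source)
    (hx : x ∈ e.triv.baseSet) (A : ∀ x, V x) :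
    𝒜.AnalyticSectionAt A x ↔ AnalyticAt ℂ (localRep φ e A) (φ x) := by
  have hc := IsManifold.chart_mem_maximalAtlas (I := 𝓘(ℂ)) (n := ω) x
  obtain ⟨L, T, c, hL, hT, hv, hW⟩ := he.exists_wronskianMatrix_eq (𝒜.isProjFlat_trivAt x) hφ hc
    hxφ (mem_chart_source ℂ x) hx (𝒜.mem_baseSet_trivAt x)
  obtain ⟨L', T', c', hL', hT', hv', hW'⟩ := (𝒜.isProjFlat_trivAt x).exists_wronskianMatrix_eq he
    hc hφ (mem_chart_source ℂ x) hxφ (𝒜.mem_baseSet_trivAt x) hx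
  exact ⟨fun h => (hW A h).1, fun h => (hW' A h).1⟩

variable {𝒜} in
theorem ProjFlatAtlas.IsProjFlat.regularSectionAt_iff {e : HolomorphicTrivialization n V}
    (he : 𝒜.IsProjFlat e) {φ : OpenPartialHomeomorph X ℂ}
    (hφ : φ ∈ IsManifold.maximalAtlas 𝓘(ℂ) ω X) {x : X} (hxφ : x ∈ φ.source)
    (hx : x ∈ e.triv.baseSet) (B : ∀ x, V x) :
    𝒜.RegularSectionAt B x ↔ AnalyticAt ℂ (localRep φ e B) (φ x) ∧
      (wronskianMatrix (localRep φ e B) (φ x)).det ≠ 0 := by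
  obtain ⟨L, T, c, hL, hT, hv, hW⟩ := he.exists_wronskianMatrix_eq (𝒜.isProjFlat_trivAt x) hφ
    (IsManifold.chart_mem_maximalAtlas x) hxφ (mem_chart_source ℂ x) hx (𝒜.mem_baseSet_trivAt x)
  rw [← he.analyticSectionAt_iff hφ hxφ hx]
  refine and_congr_right fun h => ?_
  rw [(hW B h).2, Matrix.det_mul, Matrix.det_mul]
  simp [hL.ne_zero, hT.ne_zero]

/-- The global quotient uses a different chart and frame at each point; this replaces them by one
fixed pair near a given point. -/
theorem ProjFlatAtlas.wronskianQuotient_eq_localWronskianQuotient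
    {e : HolomorphicTrivialization n V} (he : 𝒜.IsProjFlat e) {φ : OpenPartialHomeomorph X ℂ}
    (hφ : φ ∈ IsManifold.maximalAtlas 𝓘(ℂ) ω X) {x : X} (hxφ : x ∈ φ.source)
    (hx : x ∈ e.triv.baseSet) {A B : ∀ x, V x} (hA : 𝒜.AnalyticSectionAt A x)
    (hB : 𝒜.AnalyticSectionAt B x) :
    𝒜.wronskianQuotient A B x = localWronskianQuotient φ e A B x :=
  localWronskianQuotient_eq (𝒜.isProjFlat_trivAt x) he (IsManifold.chart_mem_maximalAtlas x) hφ
    (mem_chart_source ℂ x) hxφ (𝒜.mem_baseSet_trivAt x) hx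
    ((he.analyticSectionAt_iff hφ hxφ hx A).1 hA) ((he.analyticSectionAt_iff hφ hxφ hx B).1 hB)

variable [VectorBundle ℂ (Fin n → ℂ) V] [ContMDiffVectorBundle ω (Fin n → ℂ) V 𝓘(ℂ)]

theorem IsMeromorphicSection.eventually_analyticSectionAt {A : ∀ x, V x}
    (hA : IsMeromorphicSection (Fin n → ℂ) V A) (x : X) :
    ∀ᶠ y in 𝓝[≠] x, 𝒜.AnalyticSectionAt A y := by
  have hc := IsManifold.chart_mem_maximalAtlas (I := 𝓘(ℂ)) (n := ω) x
  have h := (hA.meromorphicAt_localRep hc (𝒜.trivAt x) (mem_chart_source ℂ x)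
    (𝒜.mem_baseSet_trivAt x)).eventually_analyticAt
  rw [eventually_nhdsNE_chart (mem_chart_source ℂ x)] at h
  filter_upwards [h,
    nhdsWithin_le_nhds ((chartAt ℂ x).open_source.mem_nhds (mem_chart_source ℂ x)),
    nhdsWithin_le_nhds ((𝒜.trivAt x).triv.open_baseSet.mem_nhds (𝒜.mem_baseSet_trivAt x))]
    with y hy hyφ hye
  exact ((𝒜.isProjFlat_trivAt x).analyticSectionAt_iff hc hyφ hye A).2 hy

variable {𝒜} in
theorem ProjFlatAtlas.IsProjFlat.eventually_regularSectionAt_iff {B : ∀ x, V x}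
    (hB : IsMeromorphicSection (Fin n → ℂ) V B) {e : HolomorphicTrivialization n V}
    (he : 𝒜.IsProjFlat e) {φ : OpenPartialHomeomorph X ℂ}
    (hφ : φ ∈ IsManifold.maximalAtlas 𝓘(ℂ) ω X) {x : X} (hxφ : x ∈ φ.source)
    (hx : x ∈ e.triv.baseSet) :
    ∀ᶠ y in 𝓝[≠] x, 𝒜.RegularSectionAt B y ↔
      (wronskianMatrix (localRep φ e B) (φ y)).det ≠ 0 := by
  filter_upwards [hB.eventually_analyticSectionAt 𝒜 x,
    nhdsWithin_le_nhds (φ.open_source.mem_nhds hxφ),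
    nhdsWithin_le_nhds (e.triv.open_baseSet.mem_nhds hx)] with y hy hyφ hye
  rw [he.regularSectionAt_iff hφ hyφ hye, and_iff_right_iff_imp]
  exact fun _ => (he.analyticSectionAt_iff hφ hyφ hye B).1 hy

/-- By the identity theorem, a generic section is regular off a closed discrete set. -/
theorem ProjFlatAtlas.IsGeneric.eventually_regularSectionAt [T1Space X] [PreconnectedSpace X]
    {𝒜 : ProjFlatAtlas n V} {B : ∀ x, V x} (hB : IsMeromorphicSection (Fin n → ℂ) V B)
    (hgen : 𝒜.IsGeneric B) (x : X) : ∀ᶠ y in 𝓝[≠] x, 𝒜.RegularSectionAt B y := by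
  refine forall_eventually_nhdsNE_of_dichotomy (neBot_nhdsNE_of_chartedSpace X) (fun x => ?_) ?_ x
  · have hc := IsManifold.chart_mem_maximalAtlas (I := 𝓘(ℂ)) (n := ω) x
    have hm := MeromorphicAt.matrix_det (meromorphicAt_wronskianMatrix
      (hB.meromorphicAt_localRep hc (𝒜.trivAt x) (mem_chart_source ℂ x)
        (𝒜.mem_baseSet_trivAt x)))
    have hr := (𝒜.isProjFlat_trivAt x).eventually_regularSectionAt_iff hB hc
      (mem_chart_source ℂ x) (𝒜.mem_baseSet_trivAt x)
    rcases hm.eventually_eq_zero_or_eventually_ne_zero with h | h <;>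
      rw [eventually_nhdsNE_chart (mem_chart_source ℂ x)] at h
    · right
      filter_upwards [h, hr] with y hy hry
      simp [hry, hy]
    · left
      filter_upwards [h, hr] with y hy hry
      exact hry.2 hy
  -- If regularity failed on a punctured neighbourhood of every point, the determinant in the chart
  -- and frame witnessing genericity would vanish off a discrete set.
  · obtain ⟨φ, hφ, e, he, hne⟩ := hgen
    by_contra! hcon
    refine hne (eventually_codiscreteWithin_of_forall_nhdsNE fun z hz => ?_)
    have hzs := φ.map_target hz.1
    rw [← φ.right_inv hz.1, eventually_nhdsNE_chart hzs]
    filter_upwards [hcon (φ.symm z), he.eventually_regularSectionAt_iff hB hφ hzs hz.2]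
      with y hy hry
    simpa [hry] using hy

theorem ProjFlatAtlas.isGeneric_of_eventually_regularSectionAt
    {B : ∀ x, V x} (hB : IsMeromorphicSection (Fin n → ℂ) V B) (x : X)
    (h : ∀ᶠ y in 𝓝[≠] x, 𝒜.RegularSectionAt B y) : 𝒜.IsGeneric B := by
  have hc := IsManifold.chart_mem_maximalAtlas (I := 𝓘(ℂ)) (n := ω) x
  have hx := mem_chart_source ℂ x
  refine ⟨chartAt ℂ x, hc, 𝒜.trivAt x, 𝒜.isProjFlat_trivAt x, fun hcon => ?_⟩
  have hS : chartAt ℂ x x ∈ (chartAt ℂ x).target ∩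
      (chartAt ℂ x).symm ⁻¹' (𝒜.trivAt x).triv.baseSet :=
    ⟨(chartAt ℂ x).map_source hx, by
      rw [Set.mem_preimage, (chartAt ℂ x).left_inv hx]; exact 𝒜.mem_baseSet_trivAt x⟩
  have h0 := mem_codiscreteWithin_iff_forall_mem_nhdsNE.1 hcon _ hS
  have h1 : ∀ᶠ z in 𝓝[≠] (chartAt ℂ x x),
      (wronskianMatrix (localRep (chartAt ℂ x) (𝒜.trivAt x) B) z).det = 0 := by
    filter_upwards [h0, nhdsWithin_le_nhds
      (((chartAt ℂ x).isOpen_inter_preimage_symm (𝒜.trivAt x).triv.open_baseSet).mem_nhds hS)]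
      with z hz hzS
    exact hz.resolve_right fun h => h hzS
  rw [eventually_nhdsNE_chart hx] at h1
  have := neBot_nhdsNE_of_chartedSpace X x
  obtain ⟨y, hy, hry, hzero⟩ := (h.and (((𝒜.isProjFlat_trivAt x).eventually_regularSectionAt_iff hB
    hc hx (𝒜.mem_baseSet_trivAt x)).and h1)).exists
  exact hry.1 hy hzero

/-- Near `x` the quotient has matrix `W(B)⁻¹ * W(A)` in one fixed flat frame `e`. Its matrix in the
preferred frame `e₀` is obtained by composing with the two holomorphic frame changes. -/
theorem ProjFlatAtlas.isMeromorphicSection_wronskianQuotient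
    [∀ x, IsTopologicalAddGroup (V x)] [∀ x, ContinuousSMul ℂ (V x)] {A B : ∀ x, V x}
    (hA : IsMeromorphicSection (Fin n → ℂ) V A) (hB : IsMeromorphicSection (Fin n → ℂ) V B) :
    IsMeromorphicSection ((Fin n → ℂ) →L[ℂ] (Fin n → ℂ)) (fun x => V x →L[ℂ] V x)
      (𝒜.wronskianQuotient A B) := by
  intro x
  have hc := IsManifold.chart_mem_maximalAtlas (I := 𝓘(ℂ)) (n := ω) x
  have hx := mem_chart_source ℂ x
  have hxe := 𝒜.mem_baseSet_trivAt x
  have hx₀ := mem_baseSet_trivializationAt (Fin n → ℂ) V x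
  set φ := chartAt ℂ x
  set e := 𝒜.trivAt x
  let e₀ := holomorphicTrivializationAt n V x
  refine meromorphicAt_continuousLinearMap_of_apply_single fun i => ?_
  have hm : MeromorphicAt (fun z => (frameTransition e₀ e (φ.symm z) *
      ((wronskianMatrix (localRep φ e B) z)⁻¹ * wronskianMatrix (localRep φ e A) z) *
        frameTransition e e₀ (φ.symm z)) i) (φ x) :=
    meromorphicAt_pi_iff.2 fun j => MeromorphicAt.matrix_mul (MeromorphicAt.matrix_mul
      (fun i j => (analyticAt_frameTransition e₀ e hc hx hx₀ hxe i j).meromorphicAt)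
      (MeromorphicAt.matrix_mul
        (MeromorphicAt.matrix_inv
          (meromorphicAt_wronskianMatrix (hB.meromorphicAt_localRep hc e hx hxe)))
        (meromorphicAt_wronskianMatrix (hA.meromorphicAt_localRep hc e hx hxe))))
      (fun i j => (analyticAt_frameTransition e e₀ hc hx hxe hx₀ i j).meromorphicAt) i j
  refine hm.congr ?_
  have h : ∀ᶠ y in 𝓝[≠] x, y ∈ φ.source ∧ y ∈ e.triv.baseSet ∧ y ∈ e₀.triv.baseSet ∧
      𝒜.AnalyticSectionAt A y ∧ 𝒜.AnalyticSectionAt B y := by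
    filter_upwards [hA.eventually_analyticSectionAt 𝒜 x, hB.eventually_analyticSectionAt 𝒜 x,
      nhdsWithin_le_nhds (φ.open_source.mem_nhds hx),
      nhdsWithin_le_nhds (e.triv.open_baseSet.mem_nhds hxe),
      nhdsWithin_le_nhds (e₀.triv.open_baseSet.mem_nhds hx₀)] with y h1 h2 h3 h4 h5
    exact ⟨h3, h4, h5, h1, h2⟩
  filter_upwards [(eventually_nhdsNE_chart_symm hx).2 h, nhdsWithin_le_nhds
    (φ.open_target.mem_nhds (φ.map_source hx))] with z ⟨hzφ, hze, hze₀, hzA, hzB⟩ hz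
  have key : ∀ v : Fin n → ℂ, (e₀.triv ⟨φ.symm z,
      𝒜.wronskianQuotient A B (φ.symm z) (e₀.triv.symm (φ.symm z) v)⟩).2 =
      Matrix.vecMul v (frameTransition e₀ e (φ.symm z) *
      ((wronskianMatrix (localRep φ e B) z)⁻¹ * wronskianMatrix (localRep φ e A) z) *
        frameTransition e e₀ (φ.symm z)) := fun v => by
    rw [𝒜.wronskianQuotient_eq_localWronskianQuotient (𝒜.isProjFlat_trivAt x) hc hzφ hze hzA hzB,
      snd_apply_eq_vecMul e e₀ hze hze₀, snd_apply_localWronskianQuotient _ _ _ _ hze,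
      snd_apply_symm_eq_vecMul e₀ e hze₀ hze, φ.right_inv hz, Matrix.vecMul_vecMul,
      Matrix.vecMul_vecMul]
    simp only [Matrix.mul_assoc]
  have hk := key (Pi.single i 1)
  rw [Matrix.single_one_vecMul] at hk
  refine hk.symm.trans ?_
  -- The trivialization of the endomorphism bundle sends an operator to its expression in the frame
  -- `e₀` on source and target, which is what `key` computes.
  rw [hom_trivializationAt_apply]
  simp only [ContinuousLinearMap.inCoordinates, ContinuousLinearMap.comp_apply,
    Trivialization.continuousLinearMapAt_apply]
  have hb : φ.symm z ∈ (trivializationAt (Fin n → ℂ) V x).baseSet := hze₀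
  rw [Trivialization.coe_linearMapAt_of_mem _ hb, Trivialization.symmL_apply _ hb]
  rfl

end Regular

/-! ### Assembly from punctured neighbourhoods to codiscrete sets. -/

theorem mainTheorem7 {X : Type*} [TopologicalSpace X] [T2Space X] [ConnectedSpace X]
    [ChartedSpace ℂ X] [IsManifold 𝓘(ℂ) ω X]
    (n : ℕ) (V : X → Type*) [TopologicalSpace (TotalSpace (Fin n → ℂ) V)]
    [∀ x, TopologicalSpace (V x)] [∀ x, AddCommGroup (V x)] [∀ x, Module ℂ (V x)]
    [∀ x, IsTopologicalAddGroup (V x)] [∀ x, ContinuousSMul ℂ (V x)]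
    [FiberBundle (Fin n → ℂ) V] [VectorBundle ℂ (Fin n → ℂ) V]
    [ContMDiffVectorBundle ω (Fin n → ℂ) V 𝓘(ℂ)]
    (𝒜 : ProjFlatAtlas n V) :
    -- the local formulas do not depend on chart and trivialization, and glue to a global
    -- meromorphic section of `End V`
    (∀ A B : ∀ x, V x, IsMeromorphicSection (Fin n → ℂ) V A → IsMeromorphicSection (Fin n → ℂ) V B →
      𝒜.IsGeneric B →
      (∀ φ ∈ IsManifold.maximalAtlas 𝓘(ℂ) ω X, ∀ φ' ∈ IsManifold.maximalAtlas 𝓘(ℂ) ω X,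
        ∀ e e' : HolomorphicTrivialization n V, 𝒜.IsProjFlat e → 𝒜.IsProjFlat e' →
          ∀ᶠ x in codiscreteWithin
              ((φ.source ∩ e.triv.baseSet) ∩ (φ'.source ∩ e'.triv.baseSet)),
            localWronskianQuotient φ e A B x = localWronskianQuotient φ' e' A B x) ∧
      IsMeromorphicSection ((Fin n → ℂ) →L[ℂ] (Fin n → ℂ)) (fun x => V x →L[ℂ] V x)
        (𝒜.wronskianQuotient A B) ∧
      (∀ φ ∈ IsManifold.maximalAtlas 𝓘(ℂ) ω X, ∀ e : HolomorphicTrivialization n V,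
        𝒜.IsProjFlat e →
          ∀ᶠ x in codiscreteWithin (φ.source ∩ e.triv.baseSet),
            𝒜.wronskianQuotient A B x = localWronskianQuotient φ e A B x)) ∧
    -- `(A / B) · (C / A) · (B / C) = 1`
    (∀ A B C : ∀ x, V x, IsMeromorphicSection (Fin n → ℂ) V A →
      IsMeromorphicSection (Fin n → ℂ) V B → IsMeromorphicSection (Fin n → ℂ) V C →
      𝒜.IsGeneric A → 𝒜.IsGeneric B → 𝒜.IsGeneric C →
      ∀ᶠ x in codiscrete X,
        endMul (endMul (𝒜.wronskianQuotient A B) (𝒜.wronskianQuotient C A))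
          (𝒜.wronskianQuotient B C) x = ContinuousLinearMap.id ℂ (V x)) ∧
    -- `(f A) / (f B) = A / B`
    (∀ (A B : ∀ x, V x) (f : X → ℂ), IsMeromorphicSection (Fin n → ℂ) V A →
      IsMeromorphicSection (Fin n → ℂ) V B → 𝒜.IsGeneric B →
      IsMeromorphicFunction f → (¬ ∀ᶠ x in codiscrete X, f x = 0) →
      IsMeromorphicSection (Fin n → ℂ) V (fun x => f x • A x) ∧
      IsMeromorphicSection (Fin n → ℂ) V (fun x => f x • B x) ∧
      𝒜.IsGeneric (fun x => f x • B x) ∧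
      ∀ᶠ x in codiscrete X,
        𝒜.wronskianQuotient (fun x => f x • A x) (fun x => f x • B x) x =
          𝒜.wronskianQuotient A B x) := by
  refine ⟨fun A B hA hB _ => ⟨fun φ hφ φ' hφ' e e' he he' => ?_,
    𝒜.isMeromorphicSection_wronskianQuotient hA hB, fun φ hφ e he => ?_⟩,
    fun A B C hA hB hC hgA hgB hgC => ?_, fun A B f hA hB hgB hf hne => ?_⟩
  · refine eventually_codiscreteWithin_of_forall_nhdsNE fun x ⟨⟨hxφ, hxe⟩, hxφ', hxe'⟩ => ?_
    filter_upwards [hA.eventually_analyticSectionAt 𝒜 x, hB.eventually_analyticSectionAt 𝒜 x,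
      nhdsWithin_le_nhds (φ.open_source.mem_nhds hxφ),
      nhdsWithin_le_nhds (e.triv.open_baseSet.mem_nhds hxe),
      nhdsWithin_le_nhds (φ'.open_source.mem_nhds hxφ'),
      nhdsWithin_le_nhds (e'.triv.open_baseSet.mem_nhds hxe')] with y hyA hyB h1 h2 h3 h4
    -- Both local formulas are compared with the global quotient at a common analytic point.
    exact (𝒜.wronskianQuotient_eq_localWronskianQuotient he hφ h1 h2 hyA hyB).symm.trans
      (𝒜.wronskianQuotient_eq_localWronskianQuotient he' hφ' h3 h4 hyA hyB)
  · refine eventually_codiscreteWithin_of_forall_nhdsNE fun x ⟨hxφ, hxe⟩ => ?_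
    filter_upwards [hA.eventually_analyticSectionAt 𝒜 x, hB.eventually_analyticSectionAt 𝒜 x,
      nhdsWithin_le_nhds (φ.open_source.mem_nhds hxφ),
      nhdsWithin_le_nhds (e.triv.open_baseSet.mem_nhds hxe)] with y hyA hyB h1 h2
    exact 𝒜.wronskianQuotient_eq_localWronskianQuotient he hφ h1 h2 hyA hyB
  · refine eventually_codiscreteWithin_of_forall_nhdsNE fun x _ => ?_
    filter_upwards [hgA.eventually_regularSectionAt hA x, hgB.eventually_regularSectionAt hB x,
      hgC.eventually_regularSectionAt hC x] with y hyA hyB hyC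
    exact 𝒜.endMul_wronskianQuotient_eq_id hyA hyB hyC
  · refine ⟨hA.smul hf, hB.smul hf, ?_, eventually_codiscreteWithin_of_forall_nhdsNE fun x _ => ?_⟩
    -- Genericity asks for one chart only, so regularity of `f • B` around a single point is enough.
    · obtain ⟨x⟩ := (inferInstance : Nonempty X)
      refine 𝒜.isGeneric_of_eventually_regularSectionAt (hB.smul hf) x ?_
      filter_upwards [hgB.eventually_regularSectionAt hB x, hf.eventually_analyticAt x,
        hf.eventually_ne_zero hne x] with y hyB hyf hy
      exact hyB.smul hyf hy
    · filter_upwards [hA.eventually_analyticSectionAt 𝒜 x, hB.eventually_analyticSectionAt 𝒜 x,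
        hf.eventually_analyticAt x, hf.eventually_ne_zero hne x] with y hyA hyB hyf hy
      exact 𝒜.wronskianQuotient_smul hyA hyB hyf hy
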